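/- Let $\mathbb S^n$ be the space of real symmetric $n\times n$ matrices, $\mathbb S^n_+$ the cone of positive semidefinite ones, $A\bullet B=\sum_{i,j}A_{ij}B_{ij}$, and for $S\subseteq\mathbb S^n$ let $S^\perp=\{Z\in\mathbb S^n: Z\bullet X=0\ \forall X\in S\}$. Let $K=\{1,\dots,m\}$, $A_0,A_k\in\mathbb S^n$ and $b\in\mathbb R^m$, and consider $$(P)\ \ \sup_{y,Z}\Big\{b^Ty: A_0-\sum_{k\in K}y_kA_k=Z,\ y\in\mathbb R^m,\ Z\in\mathbb S^n_+\Big\},\qquad (D)\ \ \inf_X\{A_0\bullet X: A_k\bullet X=b_k\ (k\in K),\ X\in\mathbb S^n_+\}.$$ For $t\ge 0$ and $k\in K$ let $E_k(t)\in\mathbb S^n$ be such that $E_k(0)=0$ and $E_k$ is continuous at $t=0$, and let $$(D_t)\ \ \inf_X\{A_0\bullet X:(A_k+E_k(t))\bullet X=b_k\ (k\in K),\ X\in\mathbb S^n_+\}.$$ A face of a convex set $C$ is a convex subset $F\subseteq C$ such that, whenever $x_1,x_2\in C$ and the open segment $(x_1,x_2)$ meets $F$, both $x_1,x_2\in F$.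 The minimal face of $(D)$, denoted $F_{\min}$, is the intersection of all faces of $\mathbb S^n_+$ that contain the feasible region of $(D)$; the minimal face of $(D_t)$ is defined likewise. A facial reduction sequence of $(D)$ is a sequence $(\hat y^i,\widehat U^i,\widehat V^i)$, $i=1,\dots,s$ $(s\ge 0)$, with generated faces $F_0=\mathbb S^n_+$, $F_i=F_{i-1}\cap\{\widehat U^i\}^\perp$ $(i=1,\dots,s)$, such that $F_s=F_{\min}$ and, for each $i$, $\hat y^i\in\mathbb R^m$, $\widehat U^i\in\mathbb S^n_+$, $\widehat V^i\in F_{i-1}^\perp$, $b^T\hat y^i=0$, $-\sum_{k\in K}\hat y^i_kA_k=\widehat U^i+\widehat V^i$ and $\widehat U^i+\widehat V^i\notin F_{i-1}^\perp$. Condition D: $(D)$ is feasible; $(P)$ is strictly feasible (it has a feasible point with $Z$ positive definite); $A_1,\dots,A_m$ are linearly independent; and $(D_t)$ is feasible for all sufficiently small $t>0$. Rank condition: for some $0\le r\le n$ and some orthogonal $Q$ with $F_{\min}=\Big\{Q\begin{pmatrix}O&O\\O&X\end{pmatrix}Q^T: X\in\mathbb S^r_+\Big\}$, writing $M_3$ for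 the right bottom $r\times r$ block of $M$, there is $\delta>0$ with $$\dim\operatorname{span}\{(Q^T(A_k+E_k(t))Q)_3: k\in K\}=\dim\operatorname{span}\{(Q^TA_kQ)_3: k\in K\}\qquad(0\le t\le\delta).$$ Proposition. Let $(\hat y^i,\widehat U^i,\widehat V^i)_{i=1}^s$ be a facial reduction sequence of $(D)$ with generated faces $F_0,\dots,F_s$, and let $L_i$ be the linear span of the matrices $qq^T$ over all eigenvectors $q$ of $\widehat U^i$ associated with positive eigenvalues. Suppose that Condition D and the rank condition hold and that, for each $i=1,\dots,s$ and all sufficiently small $t>0$, $$\sum_{k\in K}\hat y^i_kE_k(t)\in L_i+F_{i-1}^\perp.$$ Then $(D_t)$ has the same minimal face as $(D)$ for all sufficiently small $t>0$. -/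

import Mathlib

open scoped Matrix Topology

namespace SDP

variable {n m : ℕ}

/-- The inner product `A • B = ∑ i j, A i j * B i j` of two `n × n` matrices. -/
def dot (A B : Matrix (Fin n) (Fin n) ℝ) : ℝ := ∑ i, ∑ j, A i j * B i j

/-- The cone of real symmetric positive semidefinite `n × n` matrices. -/
def psdCone (n : ℕ) : Set (Matrix (Fin n) (Fin n) ℝ) := {X | X.PosSemidef}

/-- `S^⊥`: the symmetric matrices `Z` with `Z • X = 0` for all `X ∈ S`. -/
def perp (S : Set (Matrix (Fin n) (Fin n) ℝ)) : Submodule ℝ (Matrix (Fin n) (Fin n) ℝ) where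
  carrier := {Z | Z.IsSymm ∧ ∀ X ∈ S, dot Z X = 0}
  zero_mem' := ⟨Matrix.isSymm_zero, fun X _ => by simp [dot]⟩
  add_mem' := by
    rintro Y Z ⟨hY, hY'⟩ ⟨hZ, hZ'⟩
    refine ⟨hY.add hZ, fun X hX => ?_⟩
    have h1 := hY' X hX
    have h2 := hZ' X hX
    simp only [dot] at h1 h2 ⊢
    simp only [Matrix.add_apply, add_mul, Finset.sum_add_distrib, h1, h2, add_zero]
  smul_mem' := by
    rintro c Z ⟨hZ, hZ'⟩
    refine ⟨hZ.smul c, fun X hX => ?_⟩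
    have h1 := hZ' X hX
    simp only [dot] at h1 ⊢
    simp only [Matrix.smul_apply, smul_eq_mul, mul_assoc, ← Finset.mul_sum, h1, mul_zero]

/-- `F` is a face of the convex set `C`: a convex subset of `C` such that, whenever the open
segment between two points of `C` meets `F`, both of these points belong to `F`. -/
def IsFace (C F : Set (Matrix (Fin n) (Fin n) ℝ)) : Prop :=
  Convex ℝ F ∧ F ⊆ C ∧
    ∀ X₁ ∈ C, ∀ X₂ ∈ C, (openSegment ℝ X₁ X₂ ∩ F).Nonempty → X₁ ∈ F ∧ X₂ ∈ F

/-- The feasible region of the dual problem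
`inf {A₀ • X : A k • X = b k for all k, X positive semidefinite}`. -/
def dualFeasible (A : Fin m → Matrix (Fin n) (Fin n) ℝ) (b : Fin m → ℝ) :
    Set (Matrix (Fin n) (Fin n) ℝ) :=
  {X | X ∈ psdCone n ∧ ∀ k, dot (A k) X = b k}

/-- The primal problem `sup {b ⬝ y : A₀ - ∑ k, y k • A k = Z, Z positive semidefinite}` has a
feasible point with `Z` positive definite. -/
def PrimalStrictlyFeasible (A₀ : Matrix (Fin n) (Fin n) ℝ)
    (A : Fin m → Matrix (Fin n) (Fin n) ℝ) : Prop :=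
  ∃ y : Fin m → ℝ, (A₀ - ∑ k, y k • A k).PosDef

/-- The minimal face of the dual problem: the intersection of all faces of the positive
semidefinite cone that contain its feasible region. -/
def minimalFace (A : Fin m → Matrix (Fin n) (Fin n) ℝ) (b : Fin m → ℝ) :
    Set (Matrix (Fin n) (Fin n) ℝ) :=
  ⋂₀ {F | IsFace (psdCone n) F ∧ dualFeasible A b ⊆ F}

/-- `(y, U, V)` is a reducing certificate at the face `F`: `U` is positive semidefinite,
`V ∈ F^⊥`, `b ⬝ y = 0`, `-∑ k, y k • A k = U + V` and `U + V ∉ F^⊥`. -/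
structure IsReducingCertificate (A : Fin m → Matrix (Fin n) (Fin n) ℝ) (b : Fin m → ℝ)
    (F : Set (Matrix (Fin n) (Fin n) ℝ)) (y : Fin m → ℝ) (U V : Matrix (Fin n) (Fin n) ℝ) :
    Prop where
  psd : U ∈ psdCone n
  mem_perp : V ∈ perp F
  dot_eq_zero : ∑ k, b k * y k = 0
  eq_add : -∑ k, y k • A k = U + V
  notMem_perp : U + V ∉ perp F

/-- `(y i, U i, V i)`, `i < s`, is a facial reduction sequence of the dual problem, and
`F 0, …, F s` are the faces it generates. The `i`-th triple (counted from `0`) reduces the face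
`F i` to `F (i + 1)`. -/
structure IsFacialReductionSequence (A : Fin m → Matrix (Fin n) (Fin n) ℝ) (b : Fin m → ℝ)
    {s : ℕ} (y : Fin s → Fin m → ℝ) (U V : Fin s → Matrix (Fin n) (Fin n) ℝ)
    (F : Fin (s + 1) → Set (Matrix (Fin n) (Fin n) ℝ)) : Prop where
  start : F 0 = psdCone n
  certificate : ∀ i : Fin s, IsReducingCertificate A b (F i.castSucc) (y i) (U i) (V i)
  step : ∀ i : Fin s, F i.succ = F i.castSucc ∩ perp {U i}
  final : F (Fin.last s) = minimalFace A b

/-- The span of the matrices `q qᵀ` over all eigenvectors `q` of `U` for positive eigenvalues. -/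
def posEigenSpan (U : Matrix (Fin n) (Fin n) ℝ) : Submodule ℝ (Matrix (Fin n) (Fin n) ℝ) :=
  Submodule.span ℝ {M | ∃ (μ : ℝ) (q : Fin n → ℝ), 0 < μ ∧
    Module.End.HasEigenvector (Matrix.toLin' U) μ q ∧ M = Matrix.vecMulVec q q}

/-- The first `n - r` indices followed by the last `r` indices. -/
def blockEquiv {r : ℕ} (hr : r ≤ n) : Fin (n - r) ⊕ Fin r ≃ Fin n :=
  finSumFinEquiv.trans (finCongr (Nat.sub_add_cancel hr))

/-- `M₃`: the right bottom `r × r` block of `M`. -/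
def lowerBlock {r : ℕ} (hr : r ≤ n) (M : Matrix (Fin n) (Fin n) ℝ) : Matrix (Fin r) (Fin r) ℝ :=
  (M.submatrix (blockEquiv hr) (blockEquiv hr)).toBlocks₂₂

/-- The `n × n` matrix with right bottom `r × r` block `X` and all other blocks zero. -/
def padLower {r : ℕ} (hr : r ≤ n) (X : Matrix (Fin r) (Fin r) ℝ) : Matrix (Fin n) (Fin n) ℝ :=
  (Matrix.fromBlocks 0 0 0 X).submatrix (blockEquiv hr).symm (blockEquiv hr).symm

/-- The face `{Q (0 0; 0 X) Qᵀ : X a positive semidefinite r × r matrix}`. -/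
def blockFace {r : ℕ} (hr : r ≤ n) (Q : Matrix (Fin n) (Fin n) ℝ) :
    Set (Matrix (Fin n) (Fin n) ℝ) :=
  {Z | ∃ X ∈ psdCone r, Z = Q * padLower hr X * Qᵀ}

/-- The rank condition: for an orthogonal matrix `Q` associated to the minimal face of the
unperturbed dual problem, the dimension of the span of the blocks `(Qᵀ (A k + E k t) Q)₃` is,
for all `t` in some interval `[0, δ]` with `δ > 0`, the dimension of the span of the blocks
`(Qᵀ (A k) Q)₃`. -/
def RankCondition (A : Fin m → Matrix (Fin n) (Fin n) ℝ) (b : Fin m → ℝ)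
    (E : Fin m → ℝ → Matrix (Fin n) (Fin n) ℝ) : Prop :=
  ∃ (r : ℕ) (hr : r ≤ n), ∃ Q ∈ Matrix.orthogonalGroup (Fin n) ℝ,
    minimalFace A b = blockFace hr Q ∧
    ∃ δ > (0 : ℝ), ∀ t ∈ Set.Icc 0 δ,
      Module.finrank ℝ
          (Submodule.span ℝ (Set.range fun k => lowerBlock hr (Qᵀ * (A k + E k t) * Q))) =
        Module.finrank ℝ
          (Submodule.span ℝ (Set.range fun k => lowerBlock hr (Qᵀ * A k * Q)))

end SDP

namespace SDP

variable {n m r : ℕ}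

/-! For small `t`, the two inclusions between the minimal faces come from different hypotheses. The
feasible region of the perturbed problem stays in the old minimal face because every reducing
certificate survives. Let `X` be feasible for the perturbed problem and lie in the current face.
Pairing the certificate with `X` gives `U • X = (∑ y k • E k t) • X`. An eigenvector `q` of `U` for
`μ > 0` satisfies `q qᵀ ≤ (|q|² / μ) U`, and `F^⊥` pairs to zero with `X`, so the right side is at
most `C (U • X)`. Finite dimension makes `C` uniform in `X` and small with `t`
(`eventually_le_of_mem_dominated`). Once `C ≤ 1/2`, `U • X = 0`, and `X` passes to the next face.
Conversely, write the old minimal face as `J 𝕊₊ Jᵀ`; it has a feasible point `J X₀ Jᵀ` with `X₀`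
positive definite. By the first inclusion the perturbed constraints are consistent on this face, and
constant rank lets `X₀` be continued to solutions tending to `X₀` (`exists_tendsto_solution`). These
are eventually positive definite, and a face meeting the relative interior of `J 𝕊₊ Jᵀ` contains all
of it (`image_subset_of_isFace`). -/

/-! ### The trace pairing and quadratic forms -/

theorem dot_add_left (A B X : Matrix (Fin n) (Fin n) ℝ) : dot (A + B) X = dot A X + dot B X := by
  simp [dot, add_mul, Finset.sum_add_distrib]

theorem dot_smul_left (c : ℝ) (A X : Matrix (Fin n) (Fin n) ℝ) : dot (c • A) X = c * dot A X := by
  simp [dot, mul_assoc, Finset.mul_sum]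

/-- `M ↦ M • X` as a linear map. -/
def dotLeft (X : Matrix (Fin n) (Fin n) ℝ) : Matrix (Fin n) (Fin n) ℝ →ₗ[ℝ] ℝ where
  toFun M := dot M X
  map_add' A B := dot_add_left A B X
  map_smul' c A := dot_smul_left c A X

@[simp] theorem dotLeft_apply (X M : Matrix (Fin n) (Fin n) ℝ) : dotLeft X M = dot M X := rfl

theorem dot_comm (A B : Matrix (Fin n) (Fin n) ℝ) : dot A B = dot B A := by
  simp [dot, mul_comm]

theorem dot_self_eq_zero {A : Matrix (Fin n) (Fin n) ℝ} (h : dot A A = 0) : A = 0 := by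
  ext i j
  have h0 : ∀ i ∈ Finset.univ, 0 ≤ ∑ j, A i j * A i j := fun i _ =>
    Finset.sum_nonneg fun j _ => mul_self_nonneg _
  have h1 := (Finset.sum_eq_zero_iff_of_nonneg h0).1 h i (Finset.mem_univ i)
  have h2 := (Finset.sum_eq_zero_iff_of_nonneg fun j _ => mul_self_nonneg (A i j)).1 h1 j
    (Finset.mem_univ j)
  simpa using h2

theorem dot_eq_trace (A B : Matrix (Fin n) (Fin n) ℝ) : dot A B = (Aᵀ * B).trace := by
  simp only [dot, Matrix.trace, Matrix.diag_apply, Matrix.mul_apply, Matrix.transpose_apply]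
  exact Finset.sum_comm

/-- Cyclicity of the trace. This turns constraints on the face `J 𝕊₊ Jᵀ` into constraints on `r × r`
matrices. -/
theorem dot_conj (J : Matrix (Fin n) (Fin r) ℝ) (M : Matrix (Fin n) (Fin n) ℝ)
    (X : Matrix (Fin r) (Fin r) ℝ) : dot M (J * X * Jᵀ) = dot (Jᵀ * M * J) X := by
  rw [dot_eq_trace, dot_eq_trace, ← Matrix.mul_assoc, Matrix.trace_mul_comm]
  simp [Matrix.transpose_mul, Matrix.mul_assoc]

theorem continuous_dot_left (X : Matrix (Fin n) (Fin n) ℝ) :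
    Continuous fun M : Matrix (Fin n) (Fin n) ℝ => dot M X := by
  unfold dot
  fun_prop

/-- The quadratic form `v ↦ vᵀ M v`, linear in `M`. -/
def quadLeft (v : Fin n → ℝ) : Matrix (Fin n) (Fin n) ℝ →ₗ[ℝ] ℝ where
  toFun M := v ⬝ᵥ M *ᵥ v
  map_add' A B := by simp [Matrix.add_mulVec]
  map_smul' c A := by simp [Matrix.smul_mulVec]

@[simp] theorem quadLeft_apply (v : Fin n → ℝ) (M : Matrix (Fin n) (Fin n) ℝ) :
    quadLeft v M = v ⬝ᵥ M *ᵥ v := rfl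

theorem dot_vecMulVec (M : Matrix (Fin n) (Fin n) ℝ) (v : Fin n → ℝ) :
    dot M (Matrix.vecMulVec v v) = v ⬝ᵥ M *ᵥ v := by
  simp only [dot, Matrix.vecMulVec_apply, dotProduct, Matrix.mulVec, Finset.mul_sum]
  exact Finset.sum_congr rfl fun i _ => Finset.sum_congr rfl fun j _ => by ring

theorem isSymm_of_posSemidef {X : Matrix (Fin n) (Fin n) ℝ} (h : X.PosSemidef) : X.IsSymm := by
  simpa [Matrix.IsHermitian, Matrix.IsSymm] using h.1

theorem isHermitian_of_isSymm {X : Matrix (Fin n) (Fin n) ℝ} (h : X.IsSymm) : X.IsHermitian := by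
  simpa [Matrix.IsHermitian, Matrix.IsSymm] using h

theorem quad_nonneg {X : Matrix (Fin n) (Fin n) ℝ} (h : X.PosSemidef) (v : Fin n → ℝ) :
    0 ≤ v ⬝ᵥ X *ᵥ v := by
  simpa using h.dotProduct_mulVec_nonneg v

theorem quad_pos {X : Matrix (Fin n) (Fin n) ℝ} (h : X.PosDef) {v : Fin n → ℝ} (hv : v ≠ 0) :
    0 < v ⬝ᵥ X *ᵥ v := by
  simpa using h.dotProduct_mulVec_pos hv

/-- Pairing with a positive semidefinite matrix is monotone for the order of quadratic forms. -/
theorem dot_le_dot_of_quad_le {M N X : Matrix (Fin n) (Fin n) ℝ} (hX : X.PosSemidef)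
    (h : ∀ v : Fin n → ℝ, v ⬝ᵥ M *ᵥ v ≤ v ⬝ᵥ N *ᵥ v) : dot M X ≤ dot N X := by
  obtain ⟨k, v, rfl⟩ := Matrix.posSemidef_iff_eq_sum_vecMulVec.1 hX
  have key : ∀ M : Matrix (Fin n) (Fin n) ℝ,
      dot M (∑ i, Matrix.vecMulVec (v i) (star (v i))) = ∑ i, v i ⬝ᵥ M *ᵥ v i := by
    intro M
    rw [dot_comm, ← dotLeft_apply, map_sum]
    refine Finset.sum_congr rfl fun i _ => ?_
    rw [dotLeft_apply, dot_comm, star_trivial, dot_vecMulVec]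
  rw [key, key]
  exact Finset.sum_le_sum fun i _ => h _

theorem dot_nonneg {U X : Matrix (Fin n) (Fin n) ℝ} (hU : U.PosSemidef) (hX : X.PosSemidef) :
    0 ≤ dot U X := by
  have := dot_le_dot_of_quad_le (M := 0) (N := U) hX fun v => by simpa using quad_nonneg hU v
  simpa [dot] using this

theorem quad_symm {X : Matrix (Fin n) (Fin n) ℝ} (h : X.IsSymm) (v w : Fin n → ℝ) :
    v ⬝ᵥ X *ᵥ w = w ⬝ᵥ X *ᵥ v := by
  rw [Matrix.dotProduct_mulVec, ← Matrix.mulVec_transpose, h.eq, dotProduct_comm]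

/-- If `q` is an eigenvector of the positive semidefinite matrix `U` with eigenvalue `μ > 0`, then
`U` dominates `μ |q|⁻² q qᵀ`. -/
theorem mul_sq_le_of_eigenvector {U : Matrix (Fin n) (Fin n) ℝ} (hU : U.PosSemidef)
    {q : Fin n → ℝ} {μ : ℝ} (hq : U *ᵥ q = μ • q) (hq0 : q ≠ 0) (v : Fin n → ℝ) :
    μ * (v ⬝ᵥ q) ^ 2 ≤ (q ⬝ᵥ q) * (v ⬝ᵥ U *ᵥ v) := by
  have hqq : 0 < q ⬝ᵥ q := by
    have := Matrix.dotProduct_star_self_pos_iff (v := q) |>.2 hq0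
    simpa using this
  -- This vector is `|q|²` times the component of `v` orthogonal to `q`; its quadratic form is
  -- `|q|²` times the difference of the two sides.
  have h := quad_nonneg hU ((q ⬝ᵥ q) • v - (v ⬝ᵥ q) • q)
  have hqv : q ⬝ᵥ U *ᵥ v = μ * (v ⬝ᵥ q) := by
    rw [quad_symm (isSymm_of_posSemidef hU), hq, dotProduct_smul, smul_eq_mul]
  have hvq : v ⬝ᵥ U *ᵥ q = μ * (v ⬝ᵥ q) := by
    rw [hq, dotProduct_smul, smul_eq_mul]
  have hqUq : q ⬝ᵥ U *ᵥ q = μ * (q ⬝ᵥ q) := by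
    rw [hq, dotProduct_smul, smul_eq_mul]
  simp only [Matrix.mulVec_sub, Matrix.mulVec_smul, dotProduct_sub, sub_dotProduct,
    smul_dotProduct, dotProduct_smul, smul_eq_mul, hqv, hvq, hqUq] at h
  have h' : 0 ≤ (q ⬝ᵥ q) * ((q ⬝ᵥ q) * (v ⬝ᵥ U *ᵥ v) - μ * (v ⬝ᵥ q) ^ 2) := by
    linarith
  have := nonneg_of_mul_nonneg_right h' hqq
  linarith

/-! ### Uniform domination -/

/-- The linear forms `φ M`, indexed by `S`, that are dominated by `g` up to a constant. -/
def dominated {V S : Type*} [AddCommGroup V] [Module ℝ V] (φ : S → V →ₗ[ℝ] ℝ) (g : S → ℝ) :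
    Submodule ℝ V where
  carrier := {M | ∃ C : ℝ, ∀ x, |φ x M| ≤ C * g x}
  zero_mem' := ⟨0, fun x => by simp⟩
  add_mem' := by
    rintro M N ⟨C, hC⟩ ⟨D, hD⟩
    refine ⟨C + D, fun x => ?_⟩
    rw [map_add, add_mul]
    exact (abs_add_le _ _).trans (add_le_add (hC x) (hD x))
  smul_mem' := by
    rintro c M ⟨C, hC⟩
    refine ⟨|c| * C, fun x => ?_⟩
    rw [map_smul, smul_eq_mul, abs_mul, mul_assoc]
    exact mul_le_mul_of_nonneg_left (hC x) (abs_nonneg c)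

/-- In finite dimension the domination is uniform: vectors of the dominated submodule that tend to
zero are eventually dominated with an arbitrarily small constant. -/
theorem eventually_le_of_mem_dominated {V S T : Type*} [AddCommGroup V] [Module ℝ V]
    [TopologicalSpace V] [IsTopologicalAddGroup V] [ContinuousSMul ℝ V] [T2Space V]
    [FiniteDimensional ℝ V] (φ : S → V →ₗ[ℝ] ℝ) {g : S → ℝ} (hg : ∀ x, 0 ≤ g x)
    {l : Filter T} {M : T → V} (hM : ∀ᶠ t in l, M t ∈ dominated φ g)
    (hlim : Filter.Tendsto M l (𝓝 0)) {ε : ℝ} (hε : 0 < ε) :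
    ∀ᶠ t in l, ∀ x, |φ x (M t)| ≤ ε * g x := by
  -- A linear retraction onto the submodule extends its coordinates to all of `V`, where they are
  -- continuous and vanish at the limit `0`.
  obtain ⟨p, hp⟩ := LinearMap.exists_leftInverse_of_injective (dominated φ g).subtype
    (Submodule.ker_subtype _)
  let B := Module.finBasis ℝ (dominated φ g)
  choose C hC using fun i => (B i).2
  have hcont : Continuous fun v : V => ∑ i, |B.coord i (p v)| * C i := by
    refine continuous_finsetSum _ fun i _ => ?_
    have : Continuous ((B.coord i).comp p) := LinearMap.continuous_of_finiteDimensional _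
    exact (this.abs).mul continuous_const
  have h0 : Filter.Tendsto (fun t => ∑ i, |B.coord i (p (M t))| * C i) l (𝓝 0) := by
    have := (hcont.tendsto 0).comp hlim
    simpa [Function.comp_def] using this
  filter_upwards [hM, h0.eventually (gt_mem_nhds hε)] with t ht hlt x
  have hpt : p (M t) = ⟨M t, ht⟩ := LinearMap.congr_fun hp ⟨M t, ht⟩
  have hsum : M t = ∑ i, B.coord i (p (M t)) • (B i : V) := by
    have := congrArg (dominated φ g).subtype (B.sum_repr (p (M t)))
    rw [map_sum] at this
    simp only [map_smul, Submodule.subtype_apply] at this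
    simp only [Module.Basis.coord_apply]
    rw [this, hpt]
  calc |φ x (M t)| = |∑ i, B.coord i (p (M t)) * φ x (B i)| := by
        conv_lhs => rw [hsum]
        simp only [map_sum, map_smul, smul_eq_mul]
    _ ≤ ∑ i, |B.coord i (p (M t)) * φ x (B i)| := Finset.abs_sum_le_sum_abs _ _
    _ ≤ ∑ i, |B.coord i (p (M t))| * C i * g x := by
        refine Finset.sum_le_sum fun i _ => ?_
        rw [abs_mul, mul_assoc]
        exact mul_le_mul_of_nonneg_left (hC i x) (abs_nonneg _)
    _ = (∑ i, |B.coord i (p (M t))| * C i) * g x := by rw [Finset.sum_mul]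
    _ ≤ ε * g x := mul_le_mul_of_nonneg_right hlt.le (hg x)

/-- On a set of positive semidefinite matrices, `posEigenSpan U + F^⊥` is dominated by `U`. -/
theorem posEigenSpan_sup_perp_le {U : Matrix (Fin n) (Fin n) ℝ} (hU : U.PosSemidef)
    {F : Set (Matrix (Fin n) (Fin n) ℝ)} (hF : F ⊆ psdCone n) :
    posEigenSpan U ⊔ perp F ≤
      dominated (fun X : F => dotLeft (X : Matrix (Fin n) (Fin n) ℝ)) fun X => dot U X := by
  refine sup_le (Submodule.span_le.2 ?_) ?_
  · rintro _ ⟨μ, q, hμ, hq, rfl⟩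
    have hUq : U *ᵥ q = μ • q := by simpa using hq.apply_eq_smul
    refine ⟨(q ⬝ᵥ q) / μ, fun X => ?_⟩
    have hX : (X : Matrix (Fin n) (Fin n) ℝ).PosSemidef := hF X.2
    have hn : 0 ≤ dot (Matrix.vecMulVec q q) X := by
      refine dot_nonneg ?_ hX
      simpa using Matrix.posSemidef_vecMulVec_self_star q
    rw [dotLeft_apply, abs_of_nonneg hn, ← dot_smul_left]
    refine dot_le_dot_of_quad_le hX fun v => ?_
    have h := mul_sq_le_of_eigenvector hU hUq hq.2 v
    rw [← dot_vecMulVec, dot_comm, dot_vecMulVec, Matrix.smul_mulVec, dotProduct_smul, smul_eq_mul,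
      div_mul_eq_mul_div, le_div_iff₀ hμ]
    refine le_trans (le_of_eq ?_) h
    rw [Matrix.vecMulVec_mulVec]
    simp [dotProduct_comm q v]
    ring
  · rintro M ⟨-, hM⟩
    exact ⟨0, fun X => by simp [hM X X.2]⟩

/-! ### Stability of the facial reduction -/

/-- A perturbed reducing certificate still reduces the face `F` by `U`. -/
theorem dot_eq_zero_of_certificate {A : Fin m → Matrix (Fin n) (Fin n) ℝ} {b y : Fin m → ℝ}
    {E : Fin m → Matrix (Fin n) (Fin n) ℝ} {F : Set (Matrix (Fin n) (Fin n) ℝ)}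
    {U V X : Matrix (Fin n) (Fin n) ℝ} (hc : IsReducingCertificate A b F y U V)
    (hXF : X ∈ F) (hX : X ∈ dualFeasible (fun k => A k + E k) b)
    (hE : |dot (∑ k, y k • E k) X| ≤ 1 / 2 * dot U X) : dot U X = 0 := by
  have hpos : 0 ≤ dot U X := dot_nonneg hc.psd hX.1
  have h1 : dot (-∑ k, y k • A k) X = dot U X := by
    rw [hc.eq_add, dot_add_left, hc.mem_perp.2 X hXF, add_zero]
  have h2 : dot (∑ k, y k • A k) X + dot (∑ k, y k • E k) X = 0 := by
    rw [← dot_add_left, ← Finset.sum_add_distrib, ← hc.dot_eq_zero, ← dotLeft_apply, map_sum]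
    refine Finset.sum_congr rfl fun k _ => ?_
    rw [← smul_add, map_smul, dotLeft_apply, hX.2 k, smul_eq_mul, mul_comm]
  rw [← dotLeft_apply, map_neg, dotLeft_apply] at h1
  have h3 := (abs_le.1 hE).2
  linarith

theorem subset_psdCone_of_sequence {A : Fin m → Matrix (Fin n) (Fin n) ℝ} {b : Fin m → ℝ} {s : ℕ}
    {y : Fin s → Fin m → ℝ} {U V : Fin s → Matrix (Fin n) (Fin n) ℝ}
    {F : Fin (s + 1) → Set (Matrix (Fin n) (Fin n) ℝ)}
    (hseq : IsFacialReductionSequence A b y U V F) (i : Fin (s + 1)) : F i ⊆ psdCone n := by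
  induction i using Fin.induction with
  | zero => exact hseq.start.le
  | succ i ih =>
    rw [hseq.step i]
    exact Set.inter_subset_left.trans ih

/-- The finitely many certificates share one range of `t`; there, induction along the sequence
carries each feasible point from face to face. -/
theorem eventually_dualFeasible_subset {A : Fin m → Matrix (Fin n) (Fin n) ℝ} {b : Fin m → ℝ}
    {E : Fin m → ℝ → Matrix (Fin n) (Fin n) ℝ} {l : Filter ℝ}
    (hE : ∀ k, Filter.Tendsto (E k) l (𝓝 0)) {s : ℕ}
    {y : Fin s → Fin m → ℝ} {U V : Fin s → Matrix (Fin n) (Fin n) ℝ}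
    {F : Fin (s + 1) → Set (Matrix (Fin n) (Fin n) ℝ)}
    (hseq : IsFacialReductionSequence A b y U V F)
    (hincl : ∀ i : Fin s, ∀ᶠ t in l,
      ∑ k, y i k • E k t ∈ posEigenSpan (U i) ⊔ perp (F i.castSucc)) :
    ∀ᶠ t in l, dualFeasible (fun k => A k + E k t) b ⊆ minimalFace A b := by
  have hsmall : ∀ i : Fin s, ∀ᶠ t in l, ∀ X : F i.castSucc,
      |dot (∑ k, y i k • E k t) X| ≤ 1 / 2 * dot (U i) X := by
    intro i
    have hF := subset_psdCone_of_sequence hseq i.castSucc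
    have hU := (hseq.certificate i).psd
    have hlim : Filter.Tendsto (fun t => ∑ k, y i k • E k t) l (𝓝 0) := by
      have := tendsto_finsetSum Finset.univ fun k _ => (hE k).const_smul (y i k)
      simpa using this
    exact eventually_le_of_mem_dominated
      (fun X : F i.castSucc => dotLeft (X : Matrix (Fin n) (Fin n) ℝ))
      (fun X => dot_nonneg hU (hF X.2))
      ((hincl i).mono fun t ht => posEigenSpan_sup_perp_le hU hF ht) hlim (by norm_num)
  filter_upwards [Filter.eventually_all.2 hsmall] with t ht
  rw [← hseq.final]
  suffices ∀ i, dualFeasible (fun k => A k + E k t) b ⊆ F i from this _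
  intro i
  induction i using Fin.induction with
  | zero => rw [hseq.start]; exact fun X hX => hX.1
  | succ i ih =>
    intro X hX
    rw [hseq.step i]
    refine ⟨ih hX, isSymm_of_posSemidef hX.1, ?_⟩
    rintro _ rfl
    rw [dot_comm]
    exact dot_eq_zero_of_certificate (hseq.certificate i) (ih hX) hX (ht i ⟨X, ih hX⟩)

/-! ### Positive definite matrices, faces and kernels -/

/-- A positive definite matrix dominates every matrix, as a quadratic form. -/
theorem dominated_quadLeft_eq_top {X : Matrix (Fin n) (Fin n) ℝ} (hX : X.PosDef) :
    dominated (quadLeft (n := n)) (fun v => v ⬝ᵥ X *ᵥ v) = ⊤ := by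
  refine eq_top_iff.2 fun M _ => ?_
  have hc : ∀ N : Matrix (Fin n) (Fin n) ℝ, Continuous fun v : Fin n → ℝ => v ⬝ᵥ N *ᵥ v := fun N =>
    continuous_id.dotProduct (continuous_const.matrix_mulVec continuous_id)
  have hne : ∀ v ∈ Metric.sphere (0 : Fin n → ℝ) 1, v ⬝ᵥ X *ᵥ v ≠ 0 := fun v hv =>
    (quad_pos hX (ne_zero_of_mem_unit_sphere ⟨v, hv⟩)).ne'
  -- Both forms are homogeneous of degree two, so bounding their quotient on the compact unit sphere
  -- suffices.
  obtain ⟨C, hC⟩ := (isCompact_sphere (0 : Fin n → ℝ) 1).exists_bound_of_continuousOn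
    (f := fun v => (v ⬝ᵥ M *ᵥ v) / (v ⬝ᵥ X *ᵥ v))
    ((hc M).continuousOn.div (hc X).continuousOn hne)
  refine ⟨C, fun v => ?_⟩
  rcases eq_or_ne v 0 with rfl | hv
  · simp
  have hv' : ‖v‖ ≠ 0 := norm_ne_zero_iff.2 hv
  have hu : ‖v‖⁻¹ • v ∈ Metric.sphere (0 : Fin n → ℝ) 1 := by
    simp [norm_smul, hv']
  have h := hC _ hu
  have hpos := quad_pos hX hv
  simp only [Matrix.mulVec_smul, dotProduct_smul, smul_dotProduct, smul_eq_mul] at h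
  rw [mul_div_mul_left _ _ (inv_ne_zero hv'), mul_div_mul_left _ _ (inv_ne_zero hv'),
    Real.norm_eq_abs, abs_div, abs_of_pos hpos, div_le_iff₀ hpos] at h
  exact h

/-- Symmetric matrices that tend to a positive definite one are eventually positive definite. -/
theorem eventually_posDef {T : Type*} {l : Filter T} {X₀ : Matrix (Fin n) (Fin n) ℝ}
    (hX₀ : X₀.PosDef) {X : T → Matrix (Fin n) (Fin n) ℝ} (hlim : Filter.Tendsto X l (𝓝 X₀))
    (hX : ∀ᶠ t in l, (X t).IsSymm) : ∀ᶠ t in l, (X t).PosDef := by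
  have hlim' : Filter.Tendsto (fun t => X t - X₀) l (𝓝 0) := by
    simpa using hlim.sub_const X₀
  have := eventually_le_of_mem_dominated (quadLeft (n := n)) (quad_nonneg hX₀.posSemidef)
    (l := l) (M := fun t => X t - X₀)
    (Filter.Eventually.of_forall fun t => by rw [dominated_quadLeft_eq_top hX₀]; trivial)
    hlim' (ε := 1 / 2) (by norm_num)
  filter_upwards [this, hX] with t ht hs
  refine Matrix.PosDef.of_dotProduct_mulVec_pos (isHermitian_of_isSymm hs) fun v hv => ?_
  have h1 := (abs_le.1 (ht v)).1
  have h2 := quad_pos hX₀ hv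
  rw [map_sub, quadLeft_apply, quadLeft_apply] at h1
  rw [star_trivial]
  linarith

/-- A face of the image `J 𝕊₊ Jᵀ` of the cone that contains an interior point contains all of it. -/
theorem image_subset_of_isFace {J : Matrix (Fin n) (Fin r) ℝ} {X Y : Matrix (Fin r) (Fin r) ℝ}
    {G : Set (Matrix (Fin n) (Fin n) ℝ)} (hG : IsFace (psdCone n) G) (hX : X.PosDef)
    (hXG : J * X * Jᵀ ∈ G) (hY : Y.PosSemidef) : J * Y * Jᵀ ∈ G := by
  obtain ⟨C, hC⟩ : Y ∈ dominated (quadLeft (n := r)) (fun v => v ⬝ᵥ X *ᵥ v) := by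
    rw [dominated_quadLeft_eq_top hX]; trivial
  -- The `2` forces `ε < 1`, and `|C|` gives `ε * C ≤ 1` whatever the sign of `C`.
  set ε : ℝ := 1 / (|C| + 2) with hε
  have hε0 : 0 < ε := by positivity
  have hC0 := abs_nonneg C
  have hε1 : ε < 1 := by rw [hε, div_lt_one (by positivity)]; linarith
  have hεC : ε * C ≤ 1 := by
    rw [hε, div_mul_eq_mul_div, one_mul, div_le_one (by positivity)]
    linarith [le_abs_self C]
  have hZ : (X - ε • Y).PosSemidef := by
    refine Matrix.PosSemidef.of_dotProduct_mulVec_nonneg (isHermitian_of_isSymm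
      ((isSymm_of_posSemidef hX.posSemidef).sub ((isSymm_of_posSemidef hY).smul ε))) fun v => ?_
    have h1 := (abs_le.1 (hC v)).2
    have h2 := quad_nonneg hX.posSemidef v
    rw [star_trivial, ← quadLeft_apply, map_sub, map_smul, smul_eq_mul, quadLeft_apply]
    have h3 := mul_le_mul_of_nonneg_left h1 hε0.le
    have h4 := mul_le_mul_of_nonneg_right hεC h2
    linarith
  have hconj : ∀ {Z : Matrix (Fin r) (Fin r) ℝ}, Z.PosSemidef → J * Z * Jᵀ ∈ psdCone n := by
    intro Z hZ
    simpa [psdCone] using hZ.mul_mul_conjTranspose_same J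
  -- `X = ε Y + (1 - ε) ((1 - ε)⁻¹ (X - ε Y))`, so `J X Jᵀ` is inside a segment of the cone with
  -- endpoint `J Y Jᵀ`.
  refine (hG.2.2 _ (hconj hY) _ (hconj (hZ.smul (inv_nonneg.2 (sub_nonneg.2 hε1.le))))
    ⟨_, ⟨ε, 1 - ε, hε0, sub_pos.2 hε1, by ring, ?_⟩, hXG⟩).1
  have h1 : (1 - ε) ≠ 0 := (sub_pos.2 hε1).ne'
  rw [Matrix.mul_smul, Matrix.smul_mul, smul_smul, mul_inv_cancel₀ h1, one_smul, Matrix.mul_sub,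
    Matrix.sub_mul, Matrix.mul_smul, Matrix.smul_mul]
  abel

/-- The positive semidefinite matrices whose kernel contains that of `X` form a face. -/
theorem isFace_ker_le (X : Matrix (Fin n) (Fin n) ℝ) :
    IsFace (psdCone n) {Z | Z.PosSemidef ∧ ∀ v, X *ᵥ v = 0 → Z *ᵥ v = 0} := by
  refine ⟨?_, fun Z hZ => hZ.1, ?_⟩
  · rintro Y ⟨hY, hY'⟩ Z ⟨hZ, hZ'⟩ a c ha hc -
    refine ⟨(hY.smul ha).add (hZ.smul hc), fun v hv => ?_⟩
    simp [Matrix.add_mulVec, Matrix.smul_mulVec, hY' v hv, hZ' v hv]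
  · rintro Y hY Z hZ ⟨_, ⟨a, c, ha, hc, -, rfl⟩, -, h⟩
    have key : ∀ v, X *ᵥ v = 0 → Y *ᵥ v = 0 ∧ Z *ᵥ v = 0 := by
      intro v hv
      have h0 := congrArg (v ⬝ᵥ ·) (h v hv)
      simp only [Matrix.add_mulVec, Matrix.smul_mulVec, dotProduct_add, dotProduct_smul,
        smul_eq_mul, dotProduct_zero] at h0
      have hy := quad_nonneg hY v
      have hz := quad_nonneg hZ v
      have hy' := mul_nonneg ha.le hy
      have hz' := mul_nonneg hc.le hz
      have ey : v ⬝ᵥ Y *ᵥ v = 0 :=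
        (mul_eq_zero.1 (le_antisymm (by linarith) hy')).resolve_left ha.ne'
      have ez : v ⬝ᵥ Z *ᵥ v = 0 :=
        (mul_eq_zero.1 (le_antisymm (by linarith) hz')).resolve_left hc.ne'
      exact ⟨(hY.dotProduct_mulVec_zero_iff v).1 (by rwa [star_trivial]),
        (hZ.dotProduct_mulVec_zero_iff v).1 (by rwa [star_trivial])⟩
    exact ⟨⟨hY, fun v hv => (key v hv).1⟩, ⟨hZ, fun v hv => (key v hv).2⟩⟩

theorem convex_dualFeasible (A : Fin m → Matrix (Fin n) (Fin n) ℝ) (b : Fin m → ℝ) :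
    Convex ℝ (dualFeasible A b) := by
  rintro Y ⟨hY, hY'⟩ Z ⟨hZ, hZ'⟩ a c ha hc hac
  refine ⟨(Matrix.PosSemidef.smul hY ha).add (Matrix.PosSemidef.smul hZ hc), fun k => ?_⟩
  rw [dot_comm, dot_add_left, dot_smul_left, dot_smul_left, dot_comm Y, dot_comm Z, hY', hZ',
    ← add_mul, hac, one_mul]

/-- Some feasible point has a kernel contained in that of every feasible point. -/
theorem exists_minimal_ker {A : Fin m → Matrix (Fin n) (Fin n) ℝ} {b : Fin m → ℝ}
    (hD : (dualFeasible A b).Nonempty) :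
    ∃ X ∈ dualFeasible A b, ∀ Y ∈ dualFeasible A b, ∀ v, X *ᵥ v = 0 → Y *ᵥ v = 0 := by
  let d : Matrix (Fin n) (Fin n) ℝ → ℕ := fun X => Module.finrank ℝ (LinearMap.ker X.mulVecLin)
  obtain ⟨X, hX, hmin⟩ : ∃ X ∈ dualFeasible A b, ∀ Y ∈ dualFeasible A b, d X ≤ d Y := by
    obtain ⟨X, hX, h⟩ := (InvImage.wf d Nat.lt_wfRel.wf).has_min _ hD
    exact ⟨X, hX, fun Y hY => not_lt.1 (h Y hY)⟩
  refine ⟨X, hX, fun Y hY => ?_⟩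
  -- The kernel of the midpoint lies in both kernels; minimality of `d X` makes it equal to that of
  -- `X`.
  set Z := (1 / 2 : ℝ) • X + (1 / 2 : ℝ) • Y with hZ
  have hZD : Z ∈ dualFeasible A b :=
    convex_dualFeasible A b hX hY (by norm_num) (by norm_num) (by norm_num)
  have hker : ∀ v, Z *ᵥ v = 0 → X *ᵥ v = 0 ∧ Y *ᵥ v = 0 := by
    have hface := (isFace_ker_le Z).2.2 X hX.1 Y hY.1
      ⟨Z, ⟨1 / 2, 1 / 2, by norm_num, by norm_num, by norm_num, hZ.symm⟩, hZD.1, fun _ h => h⟩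
    exact fun v hv => ⟨hface.1.2 v hv, hface.2.2 v hv⟩
  have hle : LinearMap.ker Z.mulVecLin ≤ LinearMap.ker X.mulVecLin := fun v hv =>
    (hker v hv).1
  have heq := Submodule.eq_of_le_of_finrank_le hle (hmin Z hZD)
  intro v hv
  have : v ∈ LinearMap.ker Z.mulVecLin := heq ▸ (show v ∈ LinearMap.ker X.mulVecLin from hv)
  exact (hker v this).2

/-- If the minimal face is `J 𝕊₊ Jᵀ`, then some feasible point lies in its relative interior. -/
theorem exists_posDef_feasible {A : Fin m → Matrix (Fin n) (Fin n) ℝ} {b : Fin m → ℝ}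
    (hD : (dualFeasible A b).Nonempty) {J : Matrix (Fin n) (Fin r) ℝ} (hJ : Jᵀ * J = 1)
    (hF : minimalFace A b = {Z | ∃ X ∈ psdCone r, Z = J * X * Jᵀ}) :
    ∃ X : Matrix (Fin r) (Fin r) ℝ, X.PosDef ∧ J * X * Jᵀ ∈ dualFeasible A b := by
  obtain ⟨W, hW, hmin⟩ := exists_minimal_ker hD
  have hWF : W ∈ minimalFace A b := fun G hG => hG.2 hW
  rw [hF] at hWF
  obtain ⟨X, hX, rfl⟩ := hWF
  refine ⟨X, ?_, hW⟩
  have hJF : J * (1 : Matrix (Fin r) (Fin r) ℝ) * Jᵀ ∈ minimalFace A b := by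
    rw [hF]
    exact ⟨1, Matrix.PosSemidef.one, rfl⟩
  -- `J Jᵀ` lies in every face containing the feasible region, so it kills the kernel of `J X Jᵀ`.
  -- If `X w = 0`, this forces `J w = 0`, hence `w = 0`.
  have hJ1 := hJF _ ⟨isFace_ker_le (J * X * Jᵀ), fun Y hY => ⟨hY.1, hmin Y hY⟩⟩
  refine Matrix.PosDef.of_dotProduct_mulVec_pos hX.1 fun w hw => ?_
  rw [star_trivial]
  refine lt_of_le_of_ne (quad_nonneg hX w) fun h0 => hw ?_
  have hXw : X *ᵥ w = 0 := (hX.dotProduct_mulVec_zero_iff w).1 (by rw [star_trivial, ← h0])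
  have h1 := hJ1.2 (J *ᵥ w) (by
    rw [Matrix.mulVec_mulVec, Matrix.mul_assoc, hJ, Matrix.mul_one, ← Matrix.mulVec_mulVec, hXw,
      Matrix.mulVec_zero])
  rw [Matrix.mul_one, Matrix.mulVec_mulVec, Matrix.mul_assoc, hJ, Matrix.mul_one] at h1
  have h2 := congrArg (Jᵀ *ᵥ ·) h1
  simpa [Matrix.mulVec_mulVec, hJ] using h2

/-! ### Constant-rank linear systems -/

/-- Perturbing a linear system without changing the rank of its coefficient matrices, and keeping
it consistent, perturbs a given solution continuously. -/
theorem exists_tendsto_solution {B : ℝ → Fin m → Matrix (Fin r) (Fin r) ℝ}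
    {B₀ : Fin m → Matrix (Fin r) (Fin r) ℝ} {b : Fin m → ℝ} {l : Filter ℝ}
    (hB₀ : ∀ k, (B₀ k).IsSymm) (hlim : ∀ k, Filter.Tendsto (fun t => B t k) l (𝓝 (B₀ k)))
    (hrank : ∀ᶠ t in l, Module.finrank ℝ (Submodule.span ℝ (Set.range (B t))) =
      Module.finrank ℝ (Submodule.span ℝ (Set.range B₀)))
    (hcons : ∀ᶠ t in l, ∃ Y, ∀ k, dot (B t k) Y = b k)
    {X₀ : Matrix (Fin r) (Fin r) ℝ} (hX₀ : X₀.IsSymm) (hsol : ∀ k, dot (B₀ k) X₀ = b k) :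
    ∃ X : ℝ → Matrix (Fin r) (Fin r) ℝ, Filter.Tendsto X l (𝓝 X₀) ∧ (∀ t, (X t).IsSymm) ∧
      ∀ᶠ t in l, ∀ k, dot (B t k) (X t) = b k := by
  classical
  obtain ⟨κ, a, ha, hspan, hli⟩ := exists_linearIndependent' ℝ B₀
  have : Finite κ := Finite.of_injective a ha
  have := Fintype.ofFinite κ
  -- A mixed Gram matrix: perturbed rows against a fixed basis of the unperturbed span. Its limit
  -- `G₀` is a true Gram matrix, hence invertible.
  let G : ℝ → Matrix κ κ ℝ := fun t => Matrix.of fun i j => dot (B t (a i)) (B₀ (a j))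
  let G₀ : Matrix κ κ ℝ := Matrix.of fun i j => dot (B₀ (a i)) (B₀ (a j))
  have hdot : ∀ (k : Fin m) (Y : Matrix (Fin r) (Fin r) ℝ),
      Filter.Tendsto (fun t => dot (B t k) Y) l (𝓝 (dot (B₀ k) Y)) := fun k Y =>
    Filter.Tendsto.comp (g := fun M => dot M Y) (y := 𝓝 (B₀ k))
      ((continuous_dot_left Y).tendsto _) (hlim k)
  have hG : Filter.Tendsto G l (𝓝 G₀) :=
    tendsto_pi_nhds.2 fun i => tendsto_pi_nhds.2 fun j => hdot (a i) (B₀ (a j))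
  have hcomb : ∀ (M : Matrix (Fin r) (Fin r) ℝ) (c : κ → ℝ),
      dot M (∑ j, c j • B₀ (a j)) = ∑ j, dot M (B₀ (a j)) * c j := by
    intro M c
    rw [dot_comm, ← dotLeft_apply, map_sum]
    refine Finset.sum_congr rfl fun j _ => ?_
    rw [map_smul, dotLeft_apply, dot_comm, smul_eq_mul, mul_comm]
  have hG₀ : G₀.det ≠ 0 := by
    intro h0
    obtain ⟨c, hc, hGc⟩ := Matrix.exists_mulVec_eq_zero_iff.2 h0
    refine hc ?_
    have h1 : ∀ i, dot (B₀ (a i)) (∑ j, c j • B₀ (a j)) = 0 := fun i => by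
      rw [hcomb]
      exact congrFun hGc i
    have h2 : dot (∑ j, c j • B₀ (a j)) (∑ j, c j • B₀ (a j)) = 0 := by
      rw [hcomb]
      exact Finset.sum_eq_zero fun i _ => by rw [dot_comm, h1, zero_mul]
    exact funext (Fintype.linearIndependent_iff.1 hli c (dot_self_eq_zero h2))
  have hdet : ∀ᶠ t in l, (G t).det ≠ 0 :=
    ((continuous_id.matrix_det.tendsto G₀).comp hG).eventually_ne hG₀
  have hinv : Filter.Tendsto (fun t => (G t)⁻¹) l (𝓝 G₀⁻¹) := by
    have h : ContinuousAt Ring.inverse G₀.det := by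
      rw [Ring.inverse_eq_inv']
      exact continuousAt_inv₀ hG₀
    exact Filter.Tendsto.comp (continuousAt_matrix_inv G₀ h) hG
  let ρ : ℝ → κ → ℝ := fun t i => b (a i) - dot (B t (a i)) X₀
  have hρ : Filter.Tendsto ρ l (𝓝 0) := tendsto_pi_nhds.2 fun i => by
    have := (hdot (a i) X₀).const_sub (b (a i))
    rwa [hsol, sub_self] at this
  let c : ℝ → κ → ℝ := fun t => (G t)⁻¹ *ᵥ ρ t
  have hc : Filter.Tendsto c l (𝓝 0) := by
    have hcont : Continuous fun p : Matrix κ κ ℝ × (κ → ℝ) => p.1 *ᵥ p.2 :=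
      continuous_fst.matrix_mulVec continuous_snd
    have := (hcont.tendsto (G₀⁻¹, 0)).comp (hinv.prodMk_nhds hρ)
    simpa [Function.comp_def] using this
  -- Correct `X₀` within the unperturbed span; `c t` solves the selected equations and tends to zero
  -- with the residual `ρ t`.
  refine ⟨fun t => X₀ + ∑ j, c t j • B₀ (a j), ?_, fun t => ?_, ?_⟩
  · have := tendsto_finsetSum Finset.univ fun j _ =>
      ((tendsto_pi_nhds.1 hc j).smul_const (B₀ (a j)))
    simpa using this.const_add X₀
  · refine hX₀.add ?_
    unfold Matrix.IsSymm
    rw [Matrix.transpose_sum]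
    exact Finset.sum_congr rfl fun j _ => by rw [Matrix.transpose_smul, (hB₀ (a j)).eq]
  · filter_upwards [hdet, hrank, hcons] with t hdt hrt ⟨Y, hY⟩
    have hsub : ∀ i, dot (B t (a i)) (X₀ + ∑ j, c t j • B₀ (a j)) = b (a i) := by
      intro i
      have h1 : G t *ᵥ c t = ρ t := by
        rw [Matrix.mulVec_mulVec, Matrix.mul_nonsing_inv _ (isUnit_iff_ne_zero.2 hdt),
          Matrix.one_mulVec]
      have h2 : ∑ j, dot (B t (a i)) (B₀ (a j)) * c t j = b (a i) - dot (B t (a i)) X₀ :=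
        congrFun h1 i
      rw [dot_comm, dot_add_left, dot_comm X₀, dot_comm _ (B t (a i)), hcomb, h2]
      ring
    have hli' : LinearIndependent ℝ (B t ∘ a) := by
      refine Fintype.linearIndependent_iff.2 fun e he i => ?_
      have h1 : e ᵥ* G t = 0 := by
        ext j
        have h2 := congrArg (dotLeft (B₀ (a j))) he
        rw [map_zero] at h2
        simpa [map_sum, Matrix.vecMul, dotProduct, G] using h2
      by_contra hne
      exact hdt (Matrix.exists_vecMul_eq_zero_iff.1 ⟨e, fun h => hne (congrFun h i), h1⟩)
    -- The only use of constant rank: the selected rows still span all rows.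
    have hspan' : Submodule.span ℝ (Set.range (B t ∘ a)) = Submodule.span ℝ (Set.range (B t)) := by
      refine Submodule.eq_of_le_of_finrank_eq
        (Submodule.span_mono (Set.range_comp_subset_range a (B t))) ?_
      rw [hrt, ← hspan, finrank_span_eq_card hli, finrank_span_eq_card hli']
    intro k
    set X := X₀ + ∑ j, c t j • B₀ (a j)
    -- The solution and the consistency witness `Y` agree on the selected rows, hence on their span,
    -- which settles the other equations.
    have hle : Submodule.span ℝ (Set.range (B t ∘ a)) ≤ LinearMap.ker (dotLeft X - dotLeft Y) := by
      refine Submodule.span_le.2 ?_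
      rintro _ ⟨i, rfl⟩
      change dot (B t (a i)) X - dot (B t (a i)) Y = 0
      rw [hsub, hY, sub_self]
    have hk : dot (B t k) X - dot (B t k) Y = 0 :=
      hle (hspan' ▸ Submodule.subset_span (Set.mem_range_self k))
    rw [← hY k, sub_eq_zero.1 hk]

/-! ### Block coordinates and the reverse inclusion -/

theorem lowerBlock_conj (hr : r ≤ n) (Q M : Matrix (Fin n) (Fin n) ℝ) :
    lowerBlock hr (Qᵀ * M * Q) =
      (Q.submatrix id (blockEquiv hr ∘ Sum.inr))ᵀ * M * Q.submatrix id (blockEquiv hr ∘ Sum.inr) :=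
  rfl

/-- The zero blocks remove all but the last `r` columns of `Q`; those columns form the `J` used for
faces. -/
theorem conj_padLower (hr : r ≤ n) (Q : Matrix (Fin n) (Fin n) ℝ)
    (X : Matrix (Fin r) (Fin r) ℝ) :
    Q * padLower hr X * Qᵀ = Q.submatrix id (blockEquiv hr ∘ Sum.inr) * X *
      (Q.submatrix id (blockEquiv hr ∘ Sum.inr))ᵀ := by
  ext i j
  simp only [Matrix.mul_apply, padLower, Matrix.submatrix_apply, Matrix.transpose_apply, id,
    ← (blockEquiv hr).sum_comp, Fintype.sum_sum_type, Equiv.symm_apply_apply,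
    Matrix.fromBlocks_apply₁₁, Matrix.fromBlocks_apply₁₂, Matrix.fromBlocks_apply₂₁,
    Matrix.fromBlocks_apply₂₂, Function.comp_apply]
  simp

theorem transpose_mul_self_of_orthogonal (hr : r ≤ n) {Q : Matrix (Fin n) (Fin n) ℝ}
    (hQ : Q ∈ Matrix.orthogonalGroup (Fin n) ℝ) :
    (Q.submatrix id (blockEquiv hr ∘ Sum.inr))ᵀ * Q.submatrix id (blockEquiv hr ∘ Sum.inr) = 1 := by
  have h : Qᵀ * Q = 1 := by simpa [Matrix.star_eq_conjTranspose] using hQ.1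
  have h' := congrArg (fun M => M.submatrix (blockEquiv hr ∘ Sum.inr) (blockEquiv hr ∘ Sum.inr)) h
  rw [Matrix.submatrix_one _ ((blockEquiv hr).injective.comp Sum.inr_injective)] at h'
  exact h'

/-- Under the rank condition, the minimal face of the dual problem is contained in that of the
perturbed problem, provided the latter's feasible region is nonempty and lies in it. -/
theorem eventually_minimalFace_subset {A : Fin m → Matrix (Fin n) (Fin n) ℝ} {b : Fin m → ℝ}
    {E : Fin m → ℝ → Matrix (Fin n) (Fin n) ℝ} {l : Filter ℝ} (hA : ∀ k, (A k).IsSymm)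
    (hE : ∀ k, Filter.Tendsto (E k) l (𝓝 0)) (hD : (dualFeasible A b).Nonempty)
    {J : Matrix (Fin n) (Fin r) ℝ} (hJ : Jᵀ * J = 1)
    (hF : minimalFace A b = {Z | ∃ X ∈ psdCone r, Z = J * X * Jᵀ})
    (hrank : ∀ᶠ t in l,
      Module.finrank ℝ (Submodule.span ℝ (Set.range fun k => Jᵀ * (A k + E k t) * J)) =
        Module.finrank ℝ (Submodule.span ℝ (Set.range fun k => Jᵀ * A k * J)))
    (hDt : ∀ᶠ t in l, (dualFeasible (fun k => A k + E k t) b).Nonempty)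
    (hsub : ∀ᶠ t in l, dualFeasible (fun k => A k + E k t) b ⊆ minimalFace A b) :
    ∀ᶠ t in l, minimalFace A b ⊆ minimalFace (fun k => A k + E k t) b := by
  obtain ⟨X₀, hX₀, -, hfeas⟩ := exists_posDef_feasible hD hJ hF
  have hlim : ∀ k, Filter.Tendsto (fun t => Jᵀ * (A k + E k t) * J) l (𝓝 (Jᵀ * A k * J)) := by
    intro k
    have hc : Continuous fun M : Matrix (Fin n) (Fin n) ℝ => Jᵀ * (A k + M) * J := by fun_prop
    simpa [Function.comp_def] using (hc.tendsto 0).comp (hE k)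
  obtain ⟨X, hX, hXs, hsol⟩ := exists_tendsto_solution (b := b)
    (B := fun t k => Jᵀ * (A k + E k t) * J) (B₀ := fun k => Jᵀ * A k * J)
    (fun k => by
      simp [Matrix.IsSymm, Matrix.transpose_mul, (hA k).eq, Matrix.mul_assoc]) hlim hrank
    (by
      filter_upwards [hDt, hsub] with t ⟨W, hW⟩ hs
      have hWF := hs hW
      rw [hF] at hWF
      obtain ⟨Y, -, rfl⟩ := hWF
      exact ⟨Y, fun k => by rw [← dot_conj]; exact hW.2 k⟩)
    (isSymm_of_posSemidef hX₀.posSemidef) (fun k => by rw [← dot_conj]; exact hfeas k)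
  filter_upwards [hsol, eventually_posDef hX₀ hX (Filter.Eventually.of_forall hXs)] with t ht hp
  rw [hF]
  rintro _ ⟨Y, hY, rfl⟩ G ⟨hG, hGD⟩
  refine image_subset_of_isFace hG hp (hGD ⟨?_, fun k => ?_⟩) hY
  · simpa [psdCone] using hp.posSemidef.mul_mul_conjTranspose_same J
  · rw [dot_conj]
    exact ht k

end SDP

theorem proposition4p2 (n m : ℕ)
    -- the symmetric data of the problem and of its perturbation
    (A₀ : Matrix (Fin n) (Fin n) ℝ) (A : Fin m → Matrix (Fin n) (Fin n) ℝ) (b : Fin m → ℝ)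
    (E : Fin m → ℝ → Matrix (Fin n) (Fin n) ℝ)
    (hA₀ : A₀.IsSymm) (hA : ∀ k, (A k).IsSymm) (hE : ∀ k, ∀ t, 0 ≤ t → (E k t).IsSymm)
    (hE_zero : ∀ k, E k 0 = 0) (hE_cont : ∀ k, ContinuousWithinAt (E k) (Set.Ici 0) 0)
    -- (D) is feasible and (P) is strictly feasible
    (hD : (SDP.dualFeasible A b).Nonempty) (hP : SDP.PrimalStrictlyFeasible A₀ A)
    -- the coefficient matrices are linearly independent
    (hlin : LinearIndependent ℝ A)
    -- the perturbed dual problem is feasible for small t > 0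
    (hDt : ∀ᶠ t in 𝓝[>] (0 : ℝ), (SDP.dualFeasible (fun k => A k + E k t) b).Nonempty)
    (hrank : SDP.RankCondition A b E)
    -- a facial reduction sequence of (D) and the faces it generates
    (s : ℕ) (y : Fin s → Fin m → ℝ) (U V : Fin s → Matrix (Fin n) (Fin n) ℝ)
    (F : Fin (s + 1) → Set (Matrix (Fin n) (Fin n) ℝ))
    (hseq : SDP.IsFacialReductionSequence A b y U V F)
    (hincl : ∀ i : Fin s, ∀ᶠ t in 𝓝[>] (0 : ℝ),
      ∑ k, y i k • E k t ∈ SDP.posEigenSpan (U i) ⊔ SDP.perp (F i.castSucc)) :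
    ∀ᶠ t in 𝓝[>] (0 : ℝ),
      SDP.minimalFace (fun k => A k + E k t) b = SDP.minimalFace A b := by
  have hlim : ∀ k, Filter.Tendsto (E k) (𝓝[>] 0) (𝓝 0) := fun k => by
    have := (hE_cont k).tendsto.mono_left (nhdsWithin_mono 0 Set.Ioi_subset_Ici_self)
    rwa [hE_zero k] at this
  have hsub := SDP.eventually_dualFeasible_subset hlim hseq hincl
  obtain ⟨r, hr, Q, hQ, hF, δ, hδ, hδrank⟩ := hrank
  simp only [SDP.blockFace, SDP.conj_padLower] at hF
  simp only [SDP.lowerBlock_conj] at hδrank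
  have hsup := SDP.eventually_minimalFace_subset hA hlim hD
    (SDP.transpose_mul_self_of_orthogonal hr hQ) hF
    (Filter.mem_of_superset (Ioc_mem_nhdsGT hδ) fun t ht => hδrank t ⟨ht.1.le, ht.2⟩) hDt hsub
  filter_upwards [hsub, hsup] with t h₁ h₂
  -- By `h₁`, every face containing the feasible region of the original problem contains that of the
  -- perturbed one.
  exact Set.Subset.antisymm (fun X hX G hG => hX G ⟨hG.1, fun Y hY => h₁ hY G hG⟩) h₂
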